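/- Let $A$ be a C*-algebra (not necessarily unital) and let $E$ be a Hilbert C*-module over $A$: a complex right $A$-module with an $A$-valued inner product $\langle\cdot,\cdot\rangle$, conjugate-linear in the first variable, with $\langle x, ya\rangle=\langle x,y\rangle a$, $\langle x,y\rangle^*=\langle y,x\rangle$, $\langle x,x\rangle\ge 0$ and $\langle x,x\rangle=0$ only for $x=0$, such that $E$ is complete in the norm $\|x\|=\|\langle x,x\rangle\|^{1/2}$. (Equivalently, after replacing $A$ by its opposite algebra, the action may be written on the left, with $\langle x,ay\rangle=a\langle x,y\rangle$.) A linear operator $S$ on $E$ is adjointable if for every $y\in E$ there is $y'\in E$ with $\langle Sx,y\rangle=\langle x,y'\rangle$ for all $x\in E$; such an operator is automatically bounded, and $\mathcal L(E)$ denotes the algebra of all adjointable operators on $E$. The module $E$ is selfdual if every bounded $A$-module map $\varphi:E\to A$ has the form $\varphi(x)=\langle\xi,x\rangle$ for some $\xi\in E$. For a unital algebra $\mathfrak A$ of bounded operators on a complex normed space $X$, let $\operatorname{Lat}\mathfrak A$ be the set of closed linear subspaces of $X$ invariant under every operator in $\mathfrak A$, and for a set $\mathfrak L$ of closed subspaces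 let $\operatorname{Alg}\mathfrak L$ be the algebra of all bounded operators on $X$ leaving every member of $\mathfrak L$ invariant. The algebra $\mathfrak A$ is reflexive if $\mathfrak A=\operatorname{Alg}\operatorname{Lat}\mathfrak A$. **Corollary.** If $E$ is selfdual, then $\mathcal L(E)$ is reflexive as an algebra of operators on $E$. In particular, if $A$ is a unital C*-algebra and $n$ is a finite natural number, then $\mathcal L(A^n)$ is reflexive, where $A^n$ is the Hilbert $A$-module of $n$-tuples with inner product $\langle x,y\rangle=\sum_{i=1}^n x_i^*y_i$ (for the right action; $\sum_{i=1}^n y_ix_i^*$ for the left action). -/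

import Mathlib

open scoped InnerProductSpace

namespace HilbertReflexive

section OperatorAlgebras

variable {X : Type*} [NormedAddCommGroup X] [NormedSpace ℂ X]

/-- `Lat 𝔄`: the closed subspaces of `X` left invariant by every operator in `𝔄`. -/
def Lat (𝔄 : Subalgebra ℂ (X →L[ℂ] X)) : Set (Submodule ℂ X) :=
  {M | IsClosed (M : Set X) ∧ ∀ T ∈ 𝔄, ∀ m ∈ M, T m ∈ M}

/-- `Alg 𝔏`: the algebra of all bounded operators on `X` that leave every member of `𝔏`
invariant. -/
def Alg (𝔏 : Set (Submodule ℂ X)) : Subalgebra ℂ (X →L[ℂ] X) where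
  carrier := {T | ∀ M ∈ 𝔏, ∀ m ∈ M, T m ∈ M}
  mul_mem' hS hT M hM m hm := hS M hM _ (hT M hM m hm)
  add_mem' hS hT M hM m hm := M.add_mem (hS M hM m hm) (hT M hM m hm)
  algebraMap_mem' c M _ m hm := by
    simpa [Algebra.algebraMap_eq_smul_one] using M.smul_mem c hm

/-- A unital algebra of bounded operators is reflexive when `𝔄 = Alg Lat 𝔄`. -/
def IsReflexive (𝔄 : Subalgebra ℂ (X →L[ℂ] X)) : Prop :=
  𝔄 = Alg (Lat 𝔄)

end OperatorAlgebras

/-! Hilbert C⋆-modules are Mathlib's `CStarModule A E`, in which the action of `A` is written on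
the left: `⟪x, a • y⟫ = a * ⟪x, y⟫`. A right Hilbert module over a C⋆-algebra `B`, with
`⟪x, y b⟫ = ⟪x, y⟫ b`, is the same thing as such a module over `A = Bᵐᵒᵖ`. The module
axioms for the action of `A` follow from those of the inner product. -/

section Modules

variable (A E : Type*) [NonUnitalCStarAlgebra A] [PartialOrder A] [StarOrderedRing A]
  [NormedAddCommGroup E] [NormedSpace ℂ E] [SMul A E] [CStarModule A E]

variable {E} in
/-- A map `S : E → E` is adjointable if for every `y` there is `y'` such that
`⟪S x, y⟫ = ⟪x, y'⟫` for all `x`. -/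
def IsAdjointable (S : E → E) : Prop :=
  ∀ y : E, ∃ y' : E, ∀ x : E, ⟪S x, y⟫_A = ⟪x, y'⟫_A

/-- The algebra `L(E)` of all adjointable operators on `E`. Boundedness is no restriction here,
see `IsAdjointable.continuous`. -/
def adjointableOperators : Subalgebra ℂ (E →L[ℂ] E) where
  carrier := {S | IsAdjointable A (S : E → E)}
  mul_mem' {S T} hS hT y := by
    obtain ⟨y', hy'⟩ := hS y
    obtain ⟨y'', hy''⟩ := hT y'
    exact ⟨y'', fun x => (hy' (T x)).trans (hy'' x)⟩
  add_mem' {S T} hS hT y := by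
    obtain ⟨y', hy'⟩ := hS y
    obtain ⟨y'', hy''⟩ := hT y
    exact ⟨y' + y'', fun x => by simp [hy' x, hy'' x]⟩
  algebraMap_mem' c y := ⟨star c • y, fun x => by simp [Algebra.algebraMap_eq_smul_one]⟩

/-- `E` is selfdual if every bounded `A`-module map `φ : E → A` has the form
`x ↦ ⟪ξ, x⟫` for some `ξ` in `E`. -/
def IsSelfdual : Prop :=
  ∀ φ : E →L[ℂ] A, (∀ (a : A) (x : E), φ (a • x) = a * φ x) → ∃ ξ : E, ∀ x : E, φ x = ⟪ξ, x⟫_A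

variable {A E} in
/-- An adjointable linear operator on a Hilbert C⋆-module is automatically bounded. -/
theorem IsAdjointable.continuous [CompleteSpace E] {S : E →ₗ[ℂ] E}
    (hS : IsAdjointable A (S : E → E)) : Continuous S := by
  refine S.continuous_of_seq_closed_graph fun u x y hu hSu => ?_
  rw [← sub_eq_zero, ← CStarModule.inner_self (A := A)]
  obtain ⟨z, hz⟩ := hS (y - S x)
  have hc (w : E) : Continuous fun v : E => ⟪v, w⟫_A :=
    (CStarModule.continuous_inner (A := A) (E := E)).comp (Continuous.prodMk_left w)
  have h1 := ((hc (y - S x)).tendsto y).comp hSu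
  have h2 := ((hc z).tendsto x).comp hu
  have h3 : ⟪y, y - S x⟫_A = ⟪x, z⟫_A := by
    refine tendsto_nhds_unique h1 (h2.congr fun n => ?_)
    exact (hz (u n)).symm
  rw [CStarModule.inner_sub_left, h3, hz x, sub_self]

end Modules

end HilbertReflexive

/-! ### Commutators with tridiagonal families. -/

open scoped ComplexStarModule

/-! Adjointable maps are module maps, so the kernel of the action `π b` of any `b` in the
unitization of `A` lies in `Lat`. Hence if `T` is in `Alg Lat` and `b * c = 0`, then `π b * T * π c
= 0`. This forces commutation (`commute_of_disjoint`): cut the spectrum of a self-adjoint `h` by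
tent functions of mesh `δ`. Only neighbouring pieces interact through `T`, and three colours bound
the commutator of `π h` and `T` by a multiple of `δ` independent of the number of pieces; let `δ →
0`. So `T` is a module map, and selfduality represents `x ↦ ⟪y, T x⟫` by a vector, the value at `y`
of the adjoint of `T`. -/

open Finset in
/-- A three-colour form of the commutator of `∑ j • P j` with `T` relative to a family `P` which is
tridiagonal with respect to `T`. -/
theorem commutator_of_tridiagonal {R : Type*} [Ring R] [Algebra ℝ R] (P : ℕ → R) (T : R)
    (hP : ∀ j k, j + 1 < k ∨ k + 1 < j → P j * T * P k = 0) (s : Finset ℕ) :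
    (∑ j ∈ s, (j : ℝ) • P j) * T * (∑ k ∈ s, P k) - (∑ j ∈ s, P j) * T * (∑ k ∈ s, (k : ℝ) • P k) =
      ((∑ j ∈ s with j % 3 = 1, P j) * T * (∑ k ∈ s with k % 3 = 0, P k)
        - (∑ j ∈ s with j % 3 = 0, P j) * T * (∑ k ∈ s with k % 3 = 1, P k)) +
      ((∑ j ∈ s with j % 3 = 2, P j) * T * (∑ k ∈ s with k % 3 = 1, P k)
        - (∑ j ∈ s with j % 3 = 1, P j) * T * (∑ k ∈ s with k % 3 = 2, P k)) +
      ((∑ j ∈ s with j % 3 = 0, P j) * T * (∑ k ∈ s with k % 3 = 2, P k)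
        - (∑ j ∈ s with j % 3 = 2, P j) * T * (∑ k ∈ s with k % 3 = 0, P k)) := by
  have hQ (r : ℕ) :
      ∑ j ∈ s with j % 3 = r, P j = ∑ j ∈ s, (if j % 3 = r then (1 : ℝ) else 0) • P j := by
    rw [sum_filter]
    exact sum_congr rfl fun j _ => by split_ifs <;> simp
  have h1 : ∑ j ∈ s, P j = ∑ j ∈ s, (1 : ℝ) • P j := by simp
  have hprod (f g : ℕ → ℝ) : (∑ j ∈ s, f j • P j) * T * (∑ k ∈ s, g k • P k) =
      ∑ k ∈ s, ∑ j ∈ s, (f j * g k) • (P j * T * P k) := by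
    simp only [mul_sum, sum_mul]
    refine sum_congr rfl fun k _ => sum_congr rfl fun j _ => ?_
    rw [smul_mul_assoc, smul_mul_assoc, mul_smul_comm, smul_smul]
  rw [hQ, hQ, hQ, h1]
  simp only [hprod, ← sum_sub_distrib, ← sum_add_distrib, ← sub_smul, ← add_smul]
  refine sum_congr rfl fun k _ => sum_congr rfl fun j _ => ?_
  -- Off the three central diagonals the product vanishes; on them `j - k` is `0` or `±1`, which
  -- residues mod 3 detect.
  by_cases h : j + 1 < k ∨ k + 1 < j
  · simp [hP j k h]
  · have h3 : j = k ∨ j = k + 1 ∨ k = j + 1 := by omega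
    have hm (n : ℕ) : n % 3 = 0 ∧ (n + 1) % 3 = 1 ∨ n % 3 = 1 ∧ (n + 1) % 3 = 2 ∨
        n % 3 = 2 ∧ (n + 1) % 3 = 0 := by omega
    rcases h3 with rfl | rfl | rfl
    · rcases hm j with h | h | h <;> simp [h.1]
    · rcases hm k with h | h | h <;> simp [h.1, h.2]
    · rcases hm j with h | h | h <;> simp [h.1, h.2]

/-! ### Tent functions as a partition of unity. -/

/-- The tent function of height `1` supported on `[-1, 1]`. -/
noncomputable def tent (s : ℝ) : ℝ := max 0 (1 - |s|)

theorem continuous_tent : Continuous tent := by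
  unfold tent; fun_prop

theorem tent_nonneg (s : ℝ) : 0 ≤ tent s := le_max_left _ _

theorem tent_mul_tent_eq_zero {s t : ℝ} (h : 2 ≤ |s - t|) : tent s * tent t = 0 := by
  have h1 : 1 ≤ |s| ∨ 1 ≤ |t| := by
    by_contra! h2
    linarith [abs_sub s t]
  rcases h1 with h1 | h1 <;> simp [tent, h1]

/-- Makes the sums of tents telescope: the ramp is the remainder after `N`, and it vanishes once `s
≤ N`. -/
theorem tent_sub_natCast_succ (s : ℝ) (N : ℕ) :
    tent (s - (N + 1 : ℕ)) = max 0 (min 1 (s - N)) - max 0 (min 1 (s - (N + 1 : ℕ))) := by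
  push_cast
  simp only [tent]
  grind

theorem sum_tent_add {s : ℝ} (hs : 0 ≤ s) (N : ℕ) :
    ∑ j ∈ Finset.range (N + 1), tent (s - j) + max 0 (min 1 (s - N)) = 1 := by
  induction N with
  | zero =>
    simp only [zero_add, Finset.range_one, Finset.sum_singleton, Nat.cast_zero, sub_zero, tent,
      abs_of_nonneg hs]
    rcases le_total s 1 with h | h
    · rw [max_eq_right (by linarith), min_eq_right h, max_eq_right hs]; ring
    · rw [max_eq_left (by linarith), min_eq_left h, max_eq_right zero_le_one]; ring
  | succ N ih =>
    rw [Finset.sum_range_succ, tent_sub_natCast_succ, add_assoc, sub_add_cancel, ih]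

theorem sum_mul_tent_add {s : ℝ} (hs : 0 ≤ s) (N : ℕ) :
    ∑ j ∈ Finset.range (N + 1), (j : ℝ) * tent (s - j) + N * max 0 (min 1 (s - N)) = min s N := by
  induction N with
  | zero => simp [hs]
  | succ N ih =>
    have h' : min s (N + 1 : ℕ) = min s N + max 0 (min 1 (s - N)) := by
      push_cast
      grind
    rw [Finset.sum_range_succ, h', ← ih, tent_sub_natCast_succ]
    push_cast
    ring

theorem sum_tent {s : ℝ} {N : ℕ} (hs : 0 ≤ s) (hN : s ≤ N) :
    ∑ j ∈ Finset.range (N + 1), tent (s - j) = 1 := by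
  have := sum_tent_add hs N
  rwa [min_eq_right (by linarith), max_eq_left (by linarith), add_zero] at this

theorem sum_mul_tent {s : ℝ} {N : ℕ} (hs : 0 ≤ s) (hN : s ≤ N) :
    ∑ j ∈ Finset.range (N + 1), (j : ℝ) * tent (s - j) = s := by
  have := sum_mul_tent_add hs N
  rwa [min_eq_right (by linarith : s - N ≤ 1), max_eq_left (by linarith), mul_zero, add_zero,
    min_eq_left hN] at this

/-! ### Commutation from disjointness. -/

/-- Commutator estimate underlying `commute_of_disjoint`. -/
theorem norm_commutator_le_of_disjoint {B R : Type*} [CStarAlgebra B] [NormedRing R]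
    [NormedAlgebra ℝ R] (π : B →ₐ[ℝ] R) {C : ℝ} (hC : 0 ≤ C) (hπ : ∀ b, ‖π b‖ ≤ C * ‖b‖) {T : R}
    (hT : ∀ a b, a * b = 0 → π a * T * π b = 0) {h : B} (hh : IsSelfAdjoint h) {N : ℕ}
    (hN : 0 < N) {M : ℝ} (hM : 0 < M) (hhM : ∀ t ∈ spectrum ℝ h, |t| ≤ M) :
    ‖π h * T - T * π h‖ ≤ 12 * M * C * C * ‖T‖ / N := by
  have hN' : (0 : ℝ) < N := Nat.cast_pos.2 hN
  -- Mesh of `[-M, M]` cut into `N` intervals, with nodes `-M + j * δ` for `0 ≤ j ≤ N`.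
  set δ : ℝ := 2 * M / N with hδ
  have hδ0 : 0 < δ := by positivity
  have hs (t : ℝ) (ht : t ∈ spectrum ℝ h) : 0 ≤ (t + M) / δ ∧ (t + M) / δ ≤ N := by
    have := abs_le.1 (hhM t ht)
    refine ⟨div_nonneg (by linarith) hδ0.le, ?_⟩
    rw [div_le_iff₀ hδ0, hδ, mul_div_cancel₀ _ hN'.ne']
    linarith
  let u (j : ℕ) (t : ℝ) : ℝ := tent ((t + M) / δ - j)
  have hu (j : ℕ) : Continuous (u j) := continuous_tent.comp (by fun_prop)
  let p (j : ℕ) : B := cfc (u j) h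
  have hp_sum : ∑ j ∈ Finset.range (N + 1), p j = 1 := by
    rw [← cfc_sum u h _ fun j _ => (hu j).continuousOn, ← cfc_const_one ℝ h]
    refine cfc_congr fun t ht => ?_
    simpa [Finset.sum_apply] using sum_tent (hs t ht).1 (hs t ht).2
  have hp_mul : ∑ j ∈ Finset.range (N + 1), (j : ℝ) • p j = δ⁻¹ • (h + algebraMap ℝ B M) := by
    have h1 (j : ℕ) : (j : ℝ) • p j = cfc (fun t => (j : ℝ) * u j t) h :=
      (cfc_const_mul (j : ℝ) (u j) h (hu j).continuousOn).symm
    simp only [h1]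
    rw [← cfc_sum (fun (j : ℕ) t => (j : ℝ) * u j t) h _
      fun j _ => (continuous_const.mul (hu j)).continuousOn]
    have h2 : δ⁻¹ • (h + algebraMap ℝ B M) = cfc (fun t => δ⁻¹ * (t + M)) h := by
      rw [cfc_const_mul δ⁻¹ (fun t => t + M) h, cfc_add_const M (fun t => t) h, cfc_id' ℝ h]
    rw [h2]
    refine cfc_congr fun t ht => ?_
    have := sum_mul_tent (hs t ht).1 (hs t ht).2
    rw [Finset.sum_apply, this]
    ring
  have hP (j k : ℕ) (hjk : j + 1 < k ∨ k + 1 < j) : π (p j) * T * π (p k) = 0 := by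
    refine hT _ _ ?_
    rw [← cfc_mul _ _ _ (hu j).continuousOn (hu k).continuousOn, ← cfc_const_zero ℝ h]
    refine cfc_congr fun t _ => tent_mul_tent_eq_zero ?_
    rw [sub_sub_sub_cancel_left, le_abs]
    rcases hjk with hjk | hjk
    · left
      have : (j : ℝ) + 2 ≤ k := by exact_mod_cast hjk
      linarith
    · right
      have : (k : ℝ) + 2 ≤ j := by exact_mod_cast hjk
      linarith
  -- A colour class is part of a partition of unity, hence a function with values in `[0, 1]`: the
  -- bound does not grow with `N`.
  have hQ (r : ℕ) : ‖∑ j ∈ Finset.range (N + 1) with j % 3 = r, π (p j)‖ ≤ C := by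
    rw [← map_sum, ← cfc_sum u h _ fun j _ => (hu j).continuousOn]
    refine (hπ _).trans (mul_le_of_le_one_right hC (norm_cfc_le zero_le_one fun t ht => ?_))
    rw [Finset.sum_apply, Real.norm_of_nonneg (Finset.sum_nonneg fun j _ => tent_nonneg _),
      ← sum_tent (hs t ht).1 (hs t ht).2]
    exact Finset.sum_le_sum_of_subset_of_nonneg (Finset.filter_subset _ _)
      fun j _ _ => tent_nonneg _
  have hQQ (r s : ℕ) : ‖(∑ j ∈ Finset.range (N + 1) with j % 3 = r, π (p j)) * T *
      (∑ j ∈ Finset.range (N + 1) with j % 3 = s, π (p j))‖ ≤ C * ‖T‖ * C :=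
    (norm_mul_le _ _).trans (mul_le_mul ((norm_mul_le _ _).trans
      (mul_le_mul_of_nonneg_right (hQ r) (norm_nonneg _))) (hQ s) (norm_nonneg _) (by positivity))
  have key := commutator_of_tridiagonal (fun j => π (p j)) T hP (Finset.range (N + 1))
  have e1 : ∑ j ∈ Finset.range (N + 1), π (p j) = 1 := by rw [← map_sum, hp_sum, map_one]
  have e2 : ∑ j ∈ Finset.range (N + 1), (j : ℝ) • π (p j) =
      δ⁻¹ • (π h + algebraMap ℝ R M) := by
    simp only [← map_smul, ← map_sum]
    rw [hp_mul, map_smul, map_add, AlgHom.commutes]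
  -- The shift by the scalar `M` cancels in the commutator.
  have e3 : π h * T - T * π h = δ • (δ⁻¹ • (π h + algebraMap ℝ R M) * T * 1 -
      1 * T * δ⁻¹ • (π h + algebraMap ℝ R M)) := by
    rw [mul_one, one_mul, smul_mul_assoc, mul_smul_comm, ← smul_sub, smul_inv_smul₀ hδ0.ne',
      add_mul, mul_add, Algebra.commutes M T]
    abel
  simp only [e1, e2] at key
  rw [e3, key, norm_smul, Real.norm_of_nonneg hδ0.le]
  -- Six products, each at most `C * ‖T‖ * C`, times `δ = 2 * M / N`: this is the constant 12.
  refine (mul_le_mul_of_nonneg_left ((norm_add₃_le).trans (add_le_add (add_le_add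
    ((norm_sub_le _ _).trans (add_le_add (hQQ 1 0) (hQQ 0 1)))
    ((norm_sub_le _ _).trans (add_le_add (hQQ 2 1) (hQQ 1 2))))
    ((norm_sub_le _ _).trans (add_le_add (hQQ 0 2) (hQQ 2 0))))) hδ0.le).trans_eq ?_
  rw [hδ]
  ring

/-- Let `π` be a bounded representation of a unital C⋆-algebra. If `π a * T * π b = 0` whenever
`a * b = 0`, then `T` commutes with the range of `π`. -/
theorem commute_of_disjoint {B R : Type*} [CStarAlgebra B] [NormedRing R]
    [NormedAlgebra ℂ R] (π : B →ₐ[ℂ] R) {C : ℝ} (hC : 0 ≤ C) (hπ : ∀ b, ‖π b‖ ≤ C * ‖b‖) {T : R}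
    (hT : ∀ a b, a * b = 0 → π a * T * π b = 0) (b : B) : Commute (π b) T := by
  have hsa {h : B} (hh : IsSelfAdjoint h) : Commute (π h) T := by
    -- The factor `‖1‖` allows for the zero algebra; the summand 1 keeps the bound positive.
    have hM (t : ℝ) (ht : t ∈ spectrum ℝ h) : |t| ≤ ‖h‖ * ‖(1 : B)‖ + 1 := by
      have := spectrum.norm_le_norm_mul_of_mem ht
      rw [Real.norm_eq_abs] at this
      linarith
    have hle (N : ℕ) : ‖π h * T - T * π h‖ ≤
        12 * (‖h‖ * ‖(1 : B)‖ + 1) * C * C * ‖T‖ / ((N + 1 : ℕ) : ℝ) :=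
      norm_commutator_le_of_disjoint (π.restrictScalars ℝ) hC hπ hT hh N.succ_pos
        (by positivity) hM
    have h0 : ‖π h * T - T * π h‖ ≤ 0 :=
      ge_of_tendsto' ((tendsto_const_div_atTop_nhds_zero_nat
        (12 * (‖h‖ * ‖(1 : B)‖ + 1) * C * C * ‖T‖)).comp (Filter.tendsto_add_atTop_nat 1)) hle
    exact sub_eq_zero.1 (norm_le_zero_iff.1 h0)
  rw [← realPart_add_I_smul_imaginaryPart b, map_add, map_smul]
  exact (hsa (ℜ b).2).add_left ((hsa (ℑ b).2).smul_left Complex.I)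

/-! ### The module action and reflexivity. -/

namespace HilbertReflexive

section Action

variable {A E : Type*} [NonUnitalCStarAlgebra A] [PartialOrder A]
  [NormedAddCommGroup E] [NormedSpace ℂ E] [SMul A E] [CStarModule A E]

variable (A) in
theorem ext_inner {x y : E} (h : ∀ z : E, ⟪z, x⟫_A = ⟪z, y⟫_A) : x = y := by
  rw [← sub_eq_zero, ← CStarModule.inner_self (A := A), CStarModule.inner_sub_right, h, sub_self]

theorem norm_action_le (a : A) (x : E) : ‖a • x‖ ≤ ‖a‖ * ‖x‖ := by
  refine le_of_sq_le_sq ?_ (by positivity)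
  rw [CStarModule.norm_sq_eq A, mul_pow, CStarModule.norm_sq_eq A (x := x),
    CStarModule.inner_op_smul_right, CStarModule.inner_op_smul_left]
  calc ‖a * (⟪x, x⟫_A * star a)‖ ≤ ‖a‖ * (‖⟪x, x⟫_A‖ * ‖star a‖) :=
        (norm_mul_le _ _).trans (mul_le_mul_of_nonneg_left (norm_mul_le _ _) (norm_nonneg _))
    _ = ‖a‖ ^ 2 * ‖⟪x, x⟫_A‖ := by rw [norm_star]; ring

variable (A E) in
/-- The action of `A` on `E` by bounded operators. -/
noncomputable def actionHom : A →ₙₐ[ℂ] (E →L[ℂ] E) where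
  toFun a := LinearMap.mkContinuous
    { toFun := fun x => a • x
      map_add' := fun x y => ext_inner A fun z => by simp [mul_add]
      map_smul' := fun c x => ext_inner A fun z => by simp [mul_smul_comm] } ‖a‖ (norm_action_le a)
  map_smul' c a := by
    ext x
    exact ext_inner A fun z => by simp [smul_mul_assoc]
  map_zero' := by
    ext x
    exact ext_inner A fun z => by simp
  map_add' a b := by
    ext x
    exact ext_inner A fun z => by simp [add_mul]
  map_mul' a b := by
    ext x
    exact ext_inner A fun z => by simp [mul_assoc]

@[simp]
theorem actionHom_apply (a : A) (x : E) : actionHom A E a x = a • x := rfl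

variable (A E) in
/-- The action of the unitization of `A` on `E` by bounded operators. -/
noncomputable def unitizationActionHom : Unitization ℂ A →ₐ[ℂ] (E →L[ℂ] E) :=
  Unitization.lift (actionHom A E)

theorem unitizationActionHom_apply (b : Unitization ℂ A) (x : E) :
    unitizationActionHom A E b x = b.fst • x + b.snd • x := by
  simp [unitizationActionHom, Unitization.lift, Algebra.algebraMap_eq_smul_one]

theorem norm_unitizationActionHom_le (b : Unitization ℂ A) :
    ‖unitizationActionHom A E b‖ ≤ 3 * ‖b‖ := by
  have hfst : ‖b.fst‖ ≤ ‖b‖ := by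
    rw [Unitization.norm_eq_sup]; exact le_sup_left
  have hsnd : ‖b.snd‖ ≤ 2 * ‖b‖ := by
    have h : (b.snd : Unitization ℂ A) = b - algebraMap ℂ _ b.fst := by
      rw [Unitization.algebraMap_eq_inl, eq_sub_iff_add_eq']
      exact Unitization.inl_fst_add_inr_snd_eq b
    rw [← Unitization.norm_inr (𝕜 := ℂ), h]
    refine (norm_sub_le _ _).trans ?_
    rw [norm_algebraMap']
    linarith
  refine ContinuousLinearMap.opNorm_le_bound _ (by positivity) fun x => ?_
  rw [unitizationActionHom_apply]
  calc ‖b.fst • x + b.snd • x‖ ≤ ‖b.fst‖ * ‖x‖ + ‖b.snd‖ * ‖x‖ :=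
        (norm_add_le _ _).trans (add_le_add (norm_smul _ _).le (norm_action_le _ _))
    _ ≤ ‖b‖ * ‖x‖ + 2 * ‖b‖ * ‖x‖ := by gcongr
    _ = 3 * ‖b‖ * ‖x‖ := by ring

/-- Adjointable maps are module maps. -/
theorem IsAdjointable.map_smul {S : E → E} (hS : IsAdjointable A S) (a : A) (x : E) :
    S (a • x) = a • S x := by
  refine ext_inner A fun z => ?_
  obtain ⟨z', hz'⟩ := hS z
  have h (w : E) : ⟪z, S w⟫_A = ⟪z', w⟫_A := by
    rw [← CStarModule.star_inner, hz', CStarModule.star_inner]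
  rw [h, CStarModule.inner_op_smul_right, CStarModule.inner_op_smul_right, h]

/-- The unitization is used because the partition of unity needs a unit, which `A` may lack. -/
theorem ker_unitizationActionHom_mem_Lat (b : Unitization ℂ A) :
    (unitizationActionHom A E b).ker ∈ Lat (adjointableOperators A E) := by
  refine ⟨(unitizationActionHom A E b).isClosed_ker, fun S hS x hx => ?_⟩
  have hS' : IsAdjointable A (S : E → E) := hS
  have hx' : unitizationActionHom A E b x = 0 := hx
  have : unitizationActionHom A E b (S x) = 0 := by
    rw [unitizationActionHom_apply] at hx' ⊢
    rw [← hS'.map_smul, ← _root_.map_smul, ← map_add, hx', map_zero]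
  exact this

/-- An operator leaving invariant all closed subspaces which are invariant under the adjointable
operators is a module map. -/
theorem map_smul_of_mem_Alg_Lat {T : E →L[ℂ] E} (hT : T ∈ Alg (Lat (adjointableOperators A E)))
    (a : A) (x : E) : T (a • x) = a • T x := by
  have h : Commute (unitizationActionHom A E a) T := by
    refine commute_of_disjoint _ zero_le_three norm_unitizationActionHom_le
      (fun b c hbc => ?_) (a : Unitization ℂ A)
    ext x
    refine hT _ (ker_unitizationActionHom_mem_Lat b) _ ?_
    change unitizationActionHom A E b (unitizationActionHom A E c x) = 0
    rw [← mul_apply_eq_comp, ← map_mul, hbc, map_zero, zero_apply]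
  have h' := congr($(h.eq) x)
  simpa [unitizationActionHom_apply] using h'.symm

variable [StarOrderedRing A] in
theorem IsSelfdual.isReflexive (hE : IsSelfdual A E) :
    IsReflexive (adjointableOperators A E) := by
  refine le_antisymm (fun S hS M hM m hm => hM.2 S hS m hm) fun T hT y => ?_
  -- The representing vector `ξ` is the adjoint of `T` applied to `y`.
  obtain ⟨ξ, hξ⟩ := hE ((CStarModule.innerSL (A := A) y).comp T) fun a x => by
    rw [ContinuousLinearMap.comp_apply, ContinuousLinearMap.comp_apply,
      map_smul_of_mem_Alg_Lat hT, CStarModule.innerSL_apply, CStarModule.innerSL_apply,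
      CStarModule.inner_op_smul_right]
  refine ⟨ξ, fun x => ?_⟩
  have := hξ x
  rw [← CStarModule.star_inner, ← CStarModule.star_inner ξ x, ← this]
  rfl

end Action

theorem isSelfdual_pi (A ι : Type*) [CStarAlgebra A] [PartialOrder A] [StarOrderedRing A]
    [Fintype ι] : IsSelfdual A (WithCStarModule A (ι → A)) := by
  classical
  intro φ hφ
  let e (i : ι) : WithCStarModule A (ι → A) := (WithCStarModule.equiv A _).symm (Pi.single i 1)
  -- Since `φ x = ∑ x i * φ (e i)` and `⟪ξ, x⟫ = ∑ x i * star (ξ i)`, the coordinates of `ξ` are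
  -- forced.
  refine ⟨(WithCStarModule.equiv A _).symm fun i => star (φ (e i)), fun x => ?_⟩
  have he (z : WithCStarModule A (ι → A)) (i : ι) : ⟪z, e i⟫_A = star (z i) := by
    rw [WithCStarModule.inner_single_right, WithCStarModule.inner_def, one_mul]
  have hx : x = ∑ i, x i • e i := by
    refine ext_inner A fun z => ?_
    simp only [CStarModule.inner_sum_right, CStarModule.inner_op_smul_right, he]
    simp only [WithCStarModule.pi_inner, WithCStarModule.inner_def]
  conv_lhs => rw [hx]
  simp [hφ, WithCStarModule.pi_inner, WithCStarModule.inner_def]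

end HilbertReflexive

theorem corollary2p5 :
    (∀ (A E : Type*) [NonUnitalCStarAlgebra A] [PartialOrder A] [StarOrderedRing A]
        [NormedAddCommGroup E] [NormedSpace ℂ E] [CompleteSpace E] [SMul A E] [CStarModule A E],
        HilbertReflexive.IsSelfdual A E →
          HilbertReflexive.IsReflexive (HilbertReflexive.adjointableOperators A E)) ∧
    (∀ (A : Type*) [CStarAlgebra A] [PartialOrder A] [StarOrderedRing A] (n : ℕ),
        HilbertReflexive.IsReflexive
          (HilbertReflexive.adjointableOperators A (WithCStarModule A (Fin n → A)))) := by

  refine ⟨?_, ?_⟩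
  · intro A E _ _ _ _ _ _ _ _ hE
    exact hE.isReflexive
  · intro A _ _ _ n
    exact (HilbertReflexive.isSelfdual_pi A (Fin n)).isReflexive
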